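/- **Setting.** Terms of the $\lambda\mu$-calculus (up to renaming of bound variables) are given by $t ::= x \mid \lambda x\,t \mid (t)t \mid \mu\alpha[\beta]t$; an expression $[\beta]t$ is a named term. For $u$ a term or named term, $u[v/{*}\alpha]$ (resp. $u[v/{**}\alpha]$) is obtained from $u$ by inductively replacing each subterm $[\alpha]w$ by $[\alpha](w)v$ (resp. $[\alpha](v)w$). The reduction rules, applicable at any position in a term, are - computation: $(C_1)$ $(\lambda x\,u)v \to u[v/x]$; $(C_2)$ $(\mu\alpha\,u)v\to \mu\alpha\,u[v/{*}\alpha]$; - simplification: $(S_1)$ $[\alpha]\mu\beta\,u\to u[\alpha/\beta]$; $(S_2)$ $\mu\alpha[\alpha]u\to u$ if $\alpha$ is not free in $u$; $(S_3)$ $\mu\alpha\,u\to\lambda x\,\mu\alpha\,u[x/{*}\alpha]$ if $u$ contains a subterm $[\alpha]\lambda y\,w$; - cleaning: $(N)$ $(u)\mu\alpha\,v\to\mu\alpha\,v[u/{**}\alpha]$. A term is *normal* if it contains no redex for $(C_1),(C_2),(S_1),(S_2),(S_3)$. Write $t\hookrightarrow t'$ if $t'$ is obtained from $t$ by finitely many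 (possibly zero) steps, each consisting of one application of $(N)$ followed by simplifications until no simplification is possible. Types are the formulas of second-order predicate calculus, built with $\bot,\to,\forall$ (first and second order), over a language containing a constant $0$ and a unary function symbol $s$. Let $E$ be a set of equations between first-order terms that is *adequate*: $\not\vdash_E s(a)=0$ for every term $a$, and $\vdash_E s(a)=s(b)$ implies $\vdash_E a=b$. The judgement $\Gamma\vdash t:A,\Delta$, where $\Gamma$ assigns formulas to $\lambda$-variables and $\Delta$ assigns formulas to $\mu$-variables, is generated by the rules: - $\Gamma\vdash x:A,\Delta$ if $x:A$ is in $\Gamma$; - if $\Gamma,x:A\vdash t:B,\Delta$ then $\Gamma\vdash\lambda x\,t:A\to B,\Delta$; if $\Gamma\vdash u:A\to B,\Delta$ and $\Gamma\vdash v:A,\Delta$ then $\Gamma\vdash(u)v:B,\Delta$; - from $\Gamma\vdash t:A,\Delta$ infer $\Gamma\vdash t:\forall x A,\Delta$ (resp. $\Gamma\vdash t:\forall X A,\Delta$) if $x$ (resp. $X$) is not free in $\Gamma,\Delta$; from $\Gamma\vdash t:\forall xA,\Delta$ (resp. $\Gamma\vdash t:\forall XA,\Delta$) infer $\Gamma\vdash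 t:A[a/x],\Delta$ (resp. $\Gamma\vdash t:A[G/X],\Delta$) for any first-order term $a$ (resp. formula $G$); - from $\Gamma\vdash t:A[a/x],\Delta$ infer $\Gamma\vdash t:A[b/x],\Delta$ if $\vdash_E a=b$; - if $\Gamma\vdash t:A,\ \beta:B,\Delta$ then $\Gamma\vdash\mu\beta[\alpha]t:B,\ \alpha:A,\Delta$ when $\alpha\neq\beta$ (where $\alpha:A$ may already belong to $\Delta$), and $\Gamma\vdash\mu\beta[\beta]t:B,\Delta$ when $\alpha=\beta$ and $A=B$. Let $N[a]=\forall X\{X(0)\to(\forall y(X(y)\to X(s y))\to X(a))\}$. A *classical integer of value $n$* is a closed $\lambda\mu$-term $\theta$ such that $\vdash\theta:N[s^n(0)]$. Let $\overline n=\lambda x\lambda f\,(f)^n x$ be the $n$-th Church integer. **Statement.** For every such language, every adequate set $E$ of equations, and every natural number $n$: if $\theta$ is a normal classical integer of value $n$, then $\theta\hookrightarrow\overline n$. -/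

import Mathlib

universe u v

namespace LambdaMu

/-- `scons a σ` is the sequence `a, σ 0, σ 1, …`. -/
def scons {α : Type*} (a : α) (σ : ℕ → α) : ℕ → α
  | 0 => a
  | i + 1 => σ i

/-! ## Pure lambda-mu-calculus -/

/-- Terms of the `λμ`-calculus up to renaming of bound variables, with de Bruijn indices: the
`λ`-variables and the `μ`-variables are two separate families of indices. `mu b t` is `μα[b]t`;
it binds the `μ`-index `0` (the variable `α`), both in the name `b` and in `t`. -/
inductive Term : Type
  | var (i : ℕ) : Term
  | lam (t : Term) : Term
  | app (t s : Term) : Term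
  | mu (b : ℕ) (t : Term) : Term

namespace Term

/-- All free `λ`-indices are `< n` and all free `μ`-indices are `< m`. -/
def ClosedAt : ℕ → ℕ → Term → Prop
  | n, _, var i => i < n
  | n, m, lam t => ClosedAt (n + 1) m t
  | n, m, app t s => ClosedAt n m t ∧ ClosedAt n m s
  | n, m, mu b t => b < m + 1 ∧ ClosedAt n (m + 1) t

/-- A closed term: no free `λ`-variable and no free `μ`-variable. -/
def Closed (t : Term) : Prop := ClosedAt 0 0 t

/-- Lift a renaming under one binder. -/
def upRen (ρ : ℕ → ℕ) : ℕ → ℕ := scons 0 (fun i => ρ i + 1)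

/-- Renaming of `λ`-variables. -/
def renLam : (ℕ → ℕ) → Term → Term
  | ρ, var i => var (ρ i)
  | ρ, lam t => lam (renLam (upRen ρ) t)
  | ρ, app t s => app (renLam ρ t) (renLam ρ s)
  | ρ, mu b t => mu b (renLam ρ t)

/-- Renaming of `μ`-variables. -/
def renMu : (ℕ → ℕ) → Term → Term
  | _, var i => var i
  | ρ, lam t => lam (renMu ρ t)
  | ρ, app t s => app (renMu ρ t) (renMu ρ s)
  | ρ, mu b t => mu (upRen ρ b) (renMu (upRen ρ) t)

/-- Weakening by a fresh `λ`-variable of index `0`. -/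
def shiftLam (t : Term) : Term := renLam Nat.succ t

/-- Weakening by a fresh `μ`-variable of index `0`. -/
def shiftMu (t : Term) : Term := renMu Nat.succ t

/-- Simultaneous capture-avoiding substitution of terms for `λ`-variables. -/
def subst : (ℕ → Term) → Term → Term
  | σ, var i => σ i
  | σ, lam t => lam (subst (scons (var 0) (fun i => shiftLam (σ i))) t)
  | σ, app t s => app (subst σ t) (subst σ s)
  | σ, mu b t => mu b (subst (fun i => shiftMu (σ i)) t)

/-- `t[s/x]`, where `x` is the `λ`-index `0` of `t`. -/
def inst (t s : Term) : Term := subst (scons s var) t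

/-- `t[s/*a]`: inductively replace every subterm `[a]w` of `t` by `[a](w)s`. -/
def substRight : ℕ → Term → Term → Term
  | _, _, var i => var i
  | a, s, lam t => lam (substRight a (shiftLam s) t)
  | a, s, app t t' => app (substRight a s t) (substRight a s t')
  | a, s, mu b t =>
      mu b (if b = a + 1 then app (substRight (a + 1) (shiftMu s) t) (shiftMu s)
        else substRight (a + 1) (shiftMu s) t)

/-- `t[s/**a]`: inductively replace every subterm `[a]w` of `t` by `[a](s)w`. -/
def substLeft : ℕ → Term → Term → Term
  | _, _, var i => var i
  | a, s, lam t => lam (substLeft a (shiftLam s) t)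
  | a, s, app t t' => app (substLeft a s t) (substLeft a s t')
  | a, s, mu b t =>
      mu b (if b = a + 1 then app (shiftMu s) (substLeft (a + 1) (shiftMu s) t)
        else substLeft (a + 1) (shiftMu s) t)

/-- `μα ([b]t)[s/*α]`, where `s` lives outside the binder `μα`. -/
def muRight (b : ℕ) (t s : Term) : Term :=
  mu b (if b = 0 then app (substRight 0 (shiftMu s) t) (shiftMu s)
    else substRight 0 (shiftMu s) t)

/-- `μα ([b]t)[s/**α]`, where `s` lives outside the binder `μα`. -/
def muLeft (b : ℕ) (t s : Term) : Term :=
  mu b (if b = 0 then app (shiftMu s) (substLeft 0 (shiftMu s) t)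
    else substLeft 0 (shiftMu s) t)

/-- The term is an abstraction `λy w`. -/
def IsLam (t : Term) : Prop := ∃ w, t = lam w

/-- `t` contains a subterm of the form `[a]λy w`. -/
def NamesLam : ℕ → Term → Prop
  | _, var _ => False
  | a, lam t => NamesLam a t
  | a, app t s => NamesLam a t ∨ NamesLam a s
  | a, mu b t => (b = a + 1 ∧ IsLam t) ∨ NamesLam (a + 1) t

/-- The computation rules, at the root. -/
inductive Calc : Term → Term → Prop
  /-- `(λx t)s → t[s/x]` -/
  | c1 (t s : Term) : Calc (app (lam t) s) (inst t s)
  /-- `(μα u)s → μα u[s/*α]`, with `u = [b]t` -/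
  | c2 (b : ℕ) (t s : Term) : Calc (app (mu b t) s) (muRight b t s)

/-- The simplification rules, at the root. A named term only occurs directly below a `μ`, so the
first one is written for a named term below a `μ`. -/
inductive Simplif : Term → Term → Prop
  /-- `[a]μβ u → u[a/β]` with `u = [c]t`, below a `μ` -/
  | s1 (a c : ℕ) (t : Term) :
      Simplif (mu a (mu c t)) (mu (scons a id c) (renMu (scons a id) t))
  /-- `μα[α]t → t` if `α` is not free in `t` -/
  | s2 (t : Term) : Simplif (mu 0 (shiftMu t)) t
  /-- `μα u → λx μα u[x/*α]` if `u = [b]t` contains a subterm `[α]λy w` -/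
  | s3 (b : ℕ) (t : Term) (h : (b = 0 ∧ IsLam t) ∨ NamesLam 0 t) :
      Simplif (mu b t) (lam (muRight b (shiftLam t) (var 0)))

/-- The cleaning rule, at the root: `(s)μα u → μα u[s/**α]`, with `u = [b]t`. -/
inductive Clean : Term → Term → Prop
  | n (b : ℕ) (t s : Term) : Clean (app s (mu b t)) (muLeft b t s)

/-- One step of `R` at any position inside a term. -/
inductive Compat (R : Term → Term → Prop) : Term → Term → Prop
  | root {t t' : Term} : R t t' → Compat R t t'
  | lam {t t' : Term} : Compat R t t' → Compat R (lam t) (lam t')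
  | appL {t t' : Term} (s : Term) : Compat R t t' → Compat R (app t s) (app t' s)
  | appR {t t' : Term} (s : Term) : Compat R t t' → Compat R (app s t) (app s t')
  | mu {t t' : Term} (b : ℕ) : Compat R t t' → Compat R (mu b t) (mu b t')

/-- `t` has no redex for the relation `R`. -/
def NormalFor (R : Term → Term → Prop) (t : Term) : Prop := ∀ t', ¬ Compat R t t'

/-- Normal terms of the `λμ`-calculus: no computation redex and no simplification redex (the
cleaning rule is not taken into account). -/
def IsNormal (t : Term) : Prop := NormalFor (fun a b => Calc a b ∨ Simplif a b) t

/-- One cleaning step, followed by all possible simplifications. -/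
def CleanStep (t t' : Term) : Prop :=
  ∃ w, Compat Clean t w ∧ Relation.ReflTransGen (Compat Simplif) w t' ∧ NormalFor Simplif t'

/-- The reduction `↪`: finitely many (possibly zero) cleaning steps, each followed by all possible
simplifications. -/
def CleansTo : Term → Term → Prop := Relation.ReflTransGen CleanStep

/-- The Church integer `λx λf (f)ⁿx`. -/
def church (n : ℕ) : Term := lam (lam ((app (var 0))^[n] (var 1)))

end Term

/-! ## Second-order formulas -/

/-- Formulas of second-order predicate calculus over the language `L`, up to renaming of bound
variables. Individual variables are de Bruijn indices; for each arity `k` there is a separate family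
of de Bruijn indices for the `k`-ary relation variables. `all2 k` binds the `k`-ary relation
variable of index `0`. -/
inductive Formula (L : FirstOrder.Language.{u, v}) : Type (max u v)
  | bot : Formula L
  | rel {k : ℕ} (R : L.Relations k) (ts : Fin k → L.Term ℕ) : Formula L
  | rvar (k i : ℕ) (ts : Fin k → L.Term ℕ) : Formula L
  | imp (A B : Formula L) : Formula L
  | all1 (A : Formula L) : Formula L
  | all2 (k : ℕ) (A : Formula L) : Formula L

namespace Formula

variable {L : FirstOrder.Language.{u, v}}

/-- Individual variables as first-order terms. -/
def ivar (i : ℕ) : L.Term ℕ := FirstOrder.Language.Term.var i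

/-- Simultaneous capture-avoiding substitution of first-order terms for individual variables. -/
def subst1 : (ℕ → L.Term ℕ) → Formula L → Formula L
  | _, bot => bot
  | σ, rel R ts => rel R (fun j => (ts j).subst σ)
  | σ, rvar k i ts => rvar k i (fun j => (ts j).subst σ)
  | σ, imp A B => imp (subst1 σ A) (subst1 σ B)
  | σ, all1 A => all1 (subst1 (scons (ivar 0) (fun i => (σ i).relabel Nat.succ)) A)
  | σ, all2 k A => all2 k (subst1 σ A)

/-- Renaming of relation variables; `ρ k` acts on the `k`-ary ones. -/
def ren2 : (ℕ → ℕ → ℕ) → Formula L → Formula L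
  | _, bot => bot
  | _, rel R ts => rel R ts
  | ρ, rvar k i ts => rvar k (ρ k i) ts
  | ρ, imp A B => imp (ren2 ρ A) (ren2 ρ B)
  | ρ, all1 A => all1 (ren2 ρ A)
  | ρ, all2 n A => all2 n (ren2 (fun k => if k = n then Term.upRen (ρ k) else ρ k) A)

/-- Weakening by a fresh individual variable of index `0`. -/
def shift1 (A : Formula L) : Formula L := subst1 (fun i => ivar (i + 1)) A

/-- Weakening by a fresh `n`-ary relation variable of index `0`. -/
def shift2 (n : ℕ) (A : Formula L) : Formula L :=
  ren2 (fun k => if k = n then Nat.succ else id) A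

/-- The formula `X(x₀,…,x_{k-1})`, with `X` the `k`-ary relation variable of index `i`. -/
def atom (k i : ℕ) : Formula L := rvar k i (fun j => ivar (j : ℕ))

/-- `G[t₀/x₀,…,t_{k-1}/x_{k-1}]` for a formula `G` whose individual indices `0,…,k-1` are
parameters; the other individual variables of `G` have their indices shifted by `k`. -/
def applyParams {k : ℕ} (G : Formula L) (ts : Fin k → L.Term ℕ) : Formula L :=
  subst1 (fun j => if h : j < k then ts ⟨j, h⟩ else ivar (j - k)) G

/-- Weakening of a formula with `k` parameters by a fresh individual variable (not a parameter). -/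
def shiftParams (k : ℕ) (G : Formula L) : Formula L :=
  subst1 (fun j => if j < k then ivar j else ivar (j + 1)) G

/-- Simultaneous capture-avoiding substitution of formulas for relation variables: `σ k i`, seen as
a formula with `k` parameters, replaces the `k`-ary relation variable of index `i`. -/
def subst2 : (ℕ → ℕ → Formula L) → Formula L → Formula L
  | _, bot => bot
  | _, rel R ts => rel R ts
  | σ, rvar k i ts => applyParams (σ k i) ts
  | σ, imp A B => imp (subst2 σ A) (subst2 σ B)
  | σ, all1 A => all1 (subst2 (fun k i => shiftParams k (σ k i)) A)
  | σ, all2 n A => all2 n (subst2 (fun k =>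
      if k = n then scons (atom k 0) (fun i => shift2 n (σ k i))
      else fun i => shift2 n (σ k i)) A)

/-- `A[t/x]`, where `x` is the individual variable of index `0` of `A`. -/
def inst1 (A : Formula L) (t : L.Term ℕ) : Formula L := subst1 (scons t ivar) A

/-- `A[G/X]`, where `X` is the `n`-ary relation variable of index `0` of `A` and `G` is a formula
with `n` parameters. -/
def inst2 (n : ℕ) (A G : Formula L) : Formula L :=
  subst2 (fun k => if k = n then scons G (atom k) else atom k) A

end Formula

/-! ## Equations and typing -/

section Typing

variable {L : FirstOrder.Language.{u, v}}

/-- `E ⊢ a = b`: the equation `a = b` is a consequence of the set of equations `E` (whose variables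
are implicitly universally quantified). -/
inductive EqConseq (E : Set (L.Term ℕ × L.Term ℕ)) : L.Term ℕ → L.Term ℕ → Prop
  | ax {a b : L.Term ℕ} (h : (a, b) ∈ E) (σ : ℕ → L.Term ℕ) :
      EqConseq E (a.subst σ) (b.subst σ)
  | refl (a : L.Term ℕ) : EqConseq E a a
  | symm {a b : L.Term ℕ} : EqConseq E a b → EqConseq E b a
  | trans {a b c : L.Term ℕ} : EqConseq E a b → EqConseq E b c → EqConseq E a c
  | congr {k : ℕ} (g : L.Functions k) {as bs : Fin k → L.Term ℕ} :
      (∀ j, EqConseq E (as j) (bs j)) →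
      EqConseq E (FirstOrder.Language.Term.func g as) (FirstOrder.Language.Term.func g bs)

/-- The first-order term `0`. -/
def zeroTerm (zero : L.Functions 0) : L.Term ℕ := FirstOrder.Language.Term.func zero Fin.elim0

/-- The first-order term `s(a)`. -/
def succTerm (succ : L.Functions 1) (a : L.Term ℕ) : L.Term ℕ :=
  FirstOrder.Language.Term.func succ (fun _ => a)

/-- The set of equations `E` is adequate for the type of integers. -/
def Adequate (zero : L.Functions 0) (succ : L.Functions 1) (E : Set (L.Term ℕ × L.Term ℕ)) : Prop :=
  (∀ a, ¬ EqConseq E (succTerm succ a) (zeroTerm zero)) ∧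
  (∀ a b, EqConseq E (succTerm succ a) (succTerm succ b) → EqConseq E a b)

/-- `N[a] = ∀X (X(0), ∀y (X(y) → X(sy)) → X(a))`. -/
def natFormula (zero : L.Functions 0) (succ : L.Functions 1) (a : L.Term ℕ) : Formula L :=
  .all2 1 (.imp (.rvar 1 0 (fun _ => zeroTerm zero))
    (.imp (.all1 (.imp (.rvar 1 0 (fun _ => Formula.ivar 0))
        (.rvar 1 0 (fun _ => succTerm succ (Formula.ivar 0)))))
      (.rvar 1 0 (fun _ => a))))

/-- `HasType E Γ t A Δ` is the judgement `Γ ⊢ t : A, Δ` of second-order classical natural deduction,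
modulo the equations `E`. The formula at position `i` of `Γ` (resp. `Δ`) labels the `λ`-variable
(resp. `μ`-variable) of index `i`. -/
inductive HasType (E : Set (L.Term ℕ × L.Term ℕ)) :
    List (Formula L) → Term → Formula L → List (Formula L) → Prop
  | var {Γ Δ : List (Formula L)} {i : ℕ} {A : Formula L} (h : Γ[i]? = some A) :
      HasType E Γ (.var i) A Δ
  | lam {Γ Δ : List (Formula L)} {t : Term} {A B : Formula L} :
      HasType E (A :: Γ) t B Δ → HasType E Γ (.lam t) (.imp A B) Δ
  | app {Γ Δ : List (Formula L)} {t s : Term} {A B : Formula L} :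
      HasType E Γ t (.imp A B) Δ → HasType E Γ s A Δ → HasType E Γ (.app t s) B Δ
  | all1_intro {Γ Δ : List (Formula L)} {t : Term} {A : Formula L} :
      HasType E (Γ.map Formula.shift1) t A (Δ.map Formula.shift1) →
      HasType E Γ t (.all1 A) Δ
  | all1_elim {Γ Δ : List (Formula L)} {t : Term} {A : Formula L} (a : L.Term ℕ) :
      HasType E Γ t (.all1 A) Δ → HasType E Γ t (A.inst1 a) Δ
  | all2_intro {Γ Δ : List (Formula L)} {t : Term} {A : Formula L} (k : ℕ) :
      HasType E (Γ.map (Formula.shift2 k)) t A (Δ.map (Formula.shift2 k)) →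
      HasType E Γ t (.all2 k A) Δ
  | all2_elim {Γ Δ : List (Formula L)} {t : Term} {k : ℕ} {A : Formula L} (G : Formula L) :
      HasType E Γ t (.all2 k A) Δ → HasType E Γ t (Formula.inst2 k A G) Δ
  | eq {Γ Δ : List (Formula L)} {t : Term} (A : Formula L) {a b : L.Term ℕ} :
      EqConseq E a b → HasType E Γ t (A.inst1 a) Δ → HasType E Γ t (A.inst1 b) Δ
  /-- The new `μ`-variable has type `B` and index `0`; the name `b` may be that variable. -/
  | mu {Γ Δ : List (Formula L)} {t : Term} {A B : Formula L} {b : ℕ}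
      (h : (B :: Δ)[b]? = some A) :
      HasType E Γ t A (B :: Δ) → HasType E Γ (.mu b t) B Δ

/-- `θ` is a classical integer of value `n`: a closed `λμ`-term such that `⊢ θ : N[sⁿ(0)]`. -/
def IsClassicalInteger (zero : L.Functions 0) (succ : L.Functions 1)
    (E : Set (L.Term ℕ × L.Term ℕ)) (θ : Term) (n : ℕ) : Prop :=
  θ.Closed ∧ HasType E [] θ (natFormula zero succ ((succTerm succ)^[n] (zeroTerm zero))) []

end Typing

end LambdaMu

/-! The proof is a realizability argument on a stack machine. Environments hold closures for
λ-variables and saved stacks for μ-variables; a stack ends in a counter of pending applications of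
f. A formula is interpreted by the stacks that refute it, and `HasType.runs` shows that a typed
term, in a realizing environment, runs against each of them. In the term model of E, let X(a) be
refuted by the empty stack with counter j when a = sⁱ(0) and i + j = n. Adequacy makes `base` and
`step` realize the two hypotheses of N, so θ applied to them from counter 0 stops at counter n
(`IsClassicalInteger.runs`).

Normality leaves few shapes for such a term: θ is λxλf t with t made only of x, applications of f
and μ, a `Chain` (`IsNormal.eq_lam_lam`). A μ stores the current count and a name restores a stored
one. In an innermost cleaning redex (f)μα[β](f)ᵏx one has β ≠ α by simplification, so cleaning
merely erases an f whose count is discarded anyway (`Chain.clean_cases`). Simplifications and such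
cleanings keep the final count n and shrink the term, until (f)ⁿx is left. -/

namespace LambdaMu

/-! ## An abstract machine -/

/-- Closures: the two constants stand for the arguments `x` and `f` of a classical integer. A stack
is a list of closures on top of a counter, which records the pending applications of `f`. -/
inductive Closure : Type
  | base : Closure
  | step : Closure
  | clo (t : Term) (e : List Closure) (m : List (List Closure × ℕ)) : Closure

/-- Stacks of the machine. -/
abbrev Stack : Type := List Closure × ℕ

/-- The closure `c` run against the stack `(π, j)` reaches `base` with counter `n`. -/
inductive Runs (n : ℕ) : Closure → List Closure → ℕ → Prop
  | base : Runs n .base [] n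
  | step {c : Closure} {j : ℕ} : Runs n c [] (j + 1) → Runs n .step [c] j
  | var {i j : ℕ} {c : Closure} {e : List Closure} {m : List Stack} {π : List Closure} :
      e[i]? = some c → Runs n c π j → Runs n (.clo (.var i) e m) π j
  | lam {t : Term} {j : ℕ} {c : Closure} {e : List Closure} {m : List Stack} {π : List Closure} :
      Runs n (.clo t (c :: e) m) π j → Runs n (.clo (.lam t) e m) (c :: π) j
  | app {t s : Term} {j : ℕ} {e : List Closure} {m : List Stack} {π : List Closure} :
      Runs n (.clo t e m) (.clo s e m :: π) j → Runs n (.clo (.app t s) e m) π j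
  | mu {t : Term} {b j : ℕ} {e : List Closure} {m : List Stack} {π : List Closure} {q : Stack} :
      ((π, j) :: m)[b]? = some q → Runs n (.clo t e ((π, j) :: m)) q.1 q.2 →
      Runs n (.clo (.mu b t) e m) π j

/-! ## Falsity values of formulas -/

section Semantics

variable {L : FirstOrder.Language.{u, v}} {M : Type*} [L.Structure M]

/-- Interpretations of relation variables. -/
abbrev RelVal (M : Type*) : Type _ := (k : ℕ) → ℕ → (Fin k → M) → Set Stack

/-- Interpret the `n`-ary relation variable `0` by `P n`, shifting the other `n`-ary ones. -/
def RelVal.push (n : ℕ) (P : (k : ℕ) → (Fin k → M) → Set Stack) (r : RelVal M) : RelVal M :=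
  fun k => if k = n then scons (P k) (r k) else r k

/-- The set of stacks that refute a formula. -/
def falsity (n : ℕ) : Formula L → (ℕ → M) → RelVal M → Set Stack
  -- No typing rule is specific to ⊥ or to relation symbols, so their values are arbitrary.
  | .bot, _, _ => ∅
  | .rel _ _, _, _ => ∅
  | .rvar k i ts, v, r => r k i (fun j => (ts j).realize v)
  | .imp A B, v, r => {q | ∃ c π, q.1 = c :: π ∧ (∀ p ∈ falsity n A v r, Runs n c p.1 p.2) ∧
      (π, q.2) ∈ falsity n B v r}
  | .all1 A, v, r => ⋃ d : M, falsity n A (scons d v) r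
  -- Only the component of P at arity k matters; a family over all arities avoids transport along
  -- equalities of arities.
  | .all2 k A, v, r => ⋃ P : (k : ℕ) → (Fin k → M) → Set Stack, falsity n A v (r.push k P)

/-- The sequence `v 0, …, v (k - 1), w 0, w 1, …`. -/
def prepend {k : ℕ} (v : Fin k → M) (w : ℕ → M) (j : ℕ) : M :=
  if h : j < k then v ⟨j, h⟩ else w (j - k)

theorem falsity_subst1 (n : ℕ) (A : Formula L) (σ : ℕ → L.Term ℕ) (v : ℕ → M) (r : RelVal M) :
    falsity n (A.subst1 σ) v r = falsity n A (fun i => (σ i).realize v) r := by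
  induction A generalizing σ v r with
  | bot => rfl
  | rel R ts => rfl
  | rvar k i ts => simp [Formula.subst1, falsity, FirstOrder.Language.Term.realize_subst]
  | imp A B ihA ihB => simp only [Formula.subst1, falsity, ihA, ihB]
  | all1 A ih =>
    simp only [Formula.subst1, falsity, ih]
    refine Set.iUnion_congr fun d => congrArg (fun w => falsity n A w r) ?_
    funext i
    cases i with
    | zero => simp [scons, Formula.ivar]
    | succ i =>
      simp only [scons, FirstOrder.Language.Term.realize_relabel]
      rfl
  | all2 k A ih => simp only [Formula.subst1, falsity, ih]

theorem falsity_inst1 (n : ℕ) (A : Formula L) (a : L.Term ℕ) (v : ℕ → M) (r : RelVal M) :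
    falsity n (A.inst1 a) v r = falsity n A (scons (a.realize v) v) r := by
  rw [Formula.inst1, falsity_subst1]
  congr 1
  funext i
  cases i <;> simp [scons, Formula.ivar]

theorem falsity_shift1 (n : ℕ) (A : Formula L) (d : M) (v : ℕ → M) (r : RelVal M) :
    falsity n A.shift1 (scons d v) r = falsity n A v r := by
  rw [Formula.shift1, falsity_subst1]
  congr 1

theorem falsity_ren2 (n : ℕ) (A : Formula L) (ρ : ℕ → ℕ → ℕ) (v : ℕ → M) (r : RelVal M) :
    falsity n (A.ren2 ρ) v r = falsity n A v (fun k i => r k (ρ k i)) := by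
  induction A generalizing ρ v r with
  | bot => rfl
  | rel R ts => rfl
  | rvar k i ts => rfl
  | imp A B ihA ihB => simp only [Formula.ren2, falsity, ihA, ihB]
  | all1 A ih => simp only [Formula.ren2, falsity, ih]
  | all2 m A ih =>
    simp only [Formula.ren2, falsity, ih]
    refine Set.iUnion_congr fun P => congrArg (falsity n A v) ?_
    funext k i
    by_cases hk : k = m
    · cases i <;> simp [RelVal.push, hk, scons, Term.upRen]
    · simp [RelVal.push, hk]

theorem falsity_shift2 (n m : ℕ) (A : Formula L) (P : (k : ℕ) → (Fin k → M) → Set Stack)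
    (v : ℕ → M) (r : RelVal M) :
    falsity n (A.shift2 m) v (r.push m P) = falsity n A v r := by
  rw [Formula.shift2, falsity_ren2]
  congr 1
  funext k i
  by_cases hk : k = m <;> simp [RelVal.push, hk, scons]

theorem falsity_atom (n k i : ℕ) (w : Fin k → M) (v : ℕ → M) (r : RelVal M) :
    falsity n (Formula.atom k i : Formula L) (prepend w v) r = r k i w := by
  simp [Formula.atom, falsity, Formula.ivar, prepend]

theorem falsity_applyParams (n : ℕ) {k : ℕ} (G : Formula L) (ts : Fin k → L.Term ℕ) (v : ℕ → M)
    (r : RelVal M) :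
    falsity n (G.applyParams ts) v r =
      falsity n G (prepend (fun j => (ts j).realize v) v) r := by
  rw [Formula.applyParams, falsity_subst1]
  congr 1
  funext i
  by_cases h : i < k <;> simp [prepend, h, Formula.ivar]

theorem falsity_shiftParams (n k : ℕ) (G : Formula L) (w : Fin k → M) (d : M) (v : ℕ → M)
    (r : RelVal M) :
    falsity n (G.shiftParams k) (prepend w (scons d v)) r = falsity n G (prepend w v) r := by
  rw [Formula.shiftParams, falsity_subst1]
  congr 1
  funext i
  by_cases h : i < k
  · simp [prepend, h, Formula.ivar]
  · have h' : ¬ i + 1 < k := by omega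
    have h'' : i + 1 - k = (i - k) + 1 := by omega
    simp [prepend, h, h', h'', Formula.ivar, scons]

/-- A substituted formula acts as the predicate it defines. Such a predicate is one of the P in the
union for `all2`, which makes second-order elimination sound. -/
theorem falsity_subst2 (n : ℕ) (A : Formula L) (σ : ℕ → ℕ → Formula L) (v : ℕ → M)
    (r : RelVal M) :
    falsity n (A.subst2 σ) v r =
      falsity n A v (fun k i w => falsity n (σ k i) (prepend w v) r) := by
  induction A generalizing σ v r with
  | bot => rfl
  | rel R ts => rfl
  | rvar k i ts => simp only [Formula.subst2, falsity, falsity_applyParams]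
  | imp A B ihA ihB => simp only [Formula.subst2, falsity, ihA, ihB]
  | all1 A ih => simp only [Formula.subst2, falsity, ih, falsity_shiftParams]
  | all2 m A ih =>
    simp only [Formula.subst2, falsity, ih]
    refine Set.iUnion_congr fun P => congrArg (falsity n A v) ?_
    funext k i w
    by_cases hk : k = m
    · subst hk
      cases i with
      | zero => simp [falsity_atom, RelVal.push, scons]
      | succ i => simp [falsity_shift2, RelVal.push, scons]
    · simp [falsity_shift2, RelVal.push, hk]

theorem falsity_inst2 (n m : ℕ) (A G : Formula L) (v : ℕ → M) (r : RelVal M) :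
    falsity n (Formula.inst2 m A G) v r =
      falsity n A v (r.push m fun _ w => falsity n G (prepend w v) r) := by
  rw [Formula.inst2, falsity_subst2]
  congr 1
  funext k i w
  by_cases hk : k = m
  · subst hk
    cases i with
    | zero => simp [RelVal.push, scons]
    | succ i => simp [falsity_atom, RelVal.push, scons]
  · simp [falsity_atom, RelVal.push, hk]

theorem EqConseq.realize_eq {E : Set (L.Term ℕ × L.Term ℕ)}
    (hM : ∀ p ∈ E, ∀ v : ℕ → M, p.1.realize v = p.2.realize v) {a b : L.Term ℕ}
    (h : EqConseq E a b) (v : ℕ → M) : a.realize v = b.realize v := by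
  induction h with
  | ax h σ => simpa only [FirstOrder.Language.Term.realize_subst] using hM _ h _
  | refl a => rfl
  | symm _ ih => exact ih.symm
  | trans _ _ ih₁ ih₂ => exact ih₁.trans ih₂
  | congr g _ ih => simp only [FirstOrder.Language.Term.realize_func, ih]

theorem _root_.List.Forall₂.exists_getElem? {α β : Type*} {R : α → β → Prop} {l : List α}
    {l' : List β} (h : List.Forall₂ R l l') {i : ℕ} {a : α} (hi : l[i]? = some a) :
    ∃ b, l'[i]? = some b ∧ R a b := by
  induction h generalizing i with
  | nil => simp at hi
  | cons hab _ ih =>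
    cases i with
    | zero => simp_all
    | succ i => simpa using ih (by simpa using hi)

/-- Typed terms realize their types. -/
theorem HasType.runs {E : Set (L.Term ℕ × L.Term ℕ)}
    (hM : ∀ p ∈ E, ∀ v : ℕ → M, p.1.realize v = p.2.realize v) (n : ℕ)
    {Γ Δ : List (Formula L)} {t : Term} {A : Formula L} (h : HasType E Γ t A Δ)
    (v : ℕ → M) (r : RelVal M) (e : List Closure) (m : List Stack)
    (he : List.Forall₂ (fun A c => ∀ p ∈ falsity n A v r, Runs n c p.1 p.2) Γ e)
    (hm : List.Forall₂ (fun A q => q ∈ falsity n A v r) Δ m)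
    (q : Stack) (hq : q ∈ falsity n A v r) : Runs n (.clo t e m) q.1 q.2 := by
  induction h generalizing v r e m q with
  | var h =>
    obtain ⟨c, hc, hc'⟩ := he.exists_getElem? h
    exact .var hc (hc' q hq)
  | lam _ ih =>
    obtain ⟨_, j⟩ := q
    obtain ⟨c, π, rfl, hc, hπ⟩ := hq
    exact .lam (ih v r _ m (.cons hc he) hm _ hπ)
  | app _ _ ih₁ ih₂ =>
    exact .app (ih₁ v r e m he hm (_ :: q.1, q.2)
      ⟨_, _, rfl, fun p hp => ih₂ v r e m he hm p hp, hq⟩)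
  | all1_intro _ ih =>
    obtain ⟨d, hd⟩ := Set.mem_iUnion.1 hq
    refine ih (scons d v) r e m ?_ ?_ q hd
    · simpa only [List.forall₂_map_left_iff, falsity_shift1] using he
    · simpa only [List.forall₂_map_left_iff, falsity_shift1] using hm
  | all1_elim a _ ih =>
    rw [falsity_inst1] at hq
    exact ih v r e m he hm q (Set.mem_iUnion.2 ⟨_, hq⟩)
  | all2_intro k _ ih =>
    obtain ⟨P, hP⟩ := Set.mem_iUnion.1 hq
    refine ih v (r.push k P) e m ?_ ?_ q hP
    · simpa only [List.forall₂_map_left_iff, falsity_shift2] using he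
    · simpa only [List.forall₂_map_left_iff, falsity_shift2] using hm
  | all2_elim G _ ih =>
    rw [falsity_inst2] at hq
    exact ih v r e m he hm q (Set.mem_iUnion.2 ⟨_, hq⟩)
  | eq A hab _ ih =>
    refine ih v r e m he hm q ?_
    rwa [falsity_inst1, hab.realize_eq hM, ← falsity_inst1]
  | mu h _ ih =>
    -- The current stack refutes B, so it can be saved for the new μ-variable; the bound name and
    -- the free names are then treated alike.
    have hm' : List.Forall₂ (fun A q => q ∈ falsity n A v r) (_ :: _) (q :: m) := .cons hq hm
    obtain ⟨p, hp, hp'⟩ := hm'.exists_getElem? h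
    exact .mu hp (ih v r e _ he hm' p hp')

end Semantics

/-! ## The term model of a set of equations -/

section TermModel

variable {L : FirstOrder.Language.{u, v}} (E : Set (L.Term ℕ × L.Term ℕ))

/-- Equality of first-order terms modulo `E`. -/
def eqSetoid : Setoid (L.Term ℕ) :=
  ⟨EqConseq E, EqConseq.refl, EqConseq.symm, EqConseq.trans⟩

/-- First-order terms modulo `E`. -/
def TermModel : Type _ := Quotient (eqSetoid E)

/-- The class of a first-order term. -/
def TermModel.mk (a : L.Term ℕ) : TermModel E := Quotient.mk (eqSetoid E) a

variable {E}

theorem TermModel.mk_eq_iff {a b : L.Term ℕ} : mk E a = mk E b ↔ EqConseq E a b :=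
  Quotient.eq (r := eqSetoid E)

theorem TermModel.exists_mk (d : TermModel E) : ∃ a, mk E a = d :=
  Quotient.exists_rep d

/-- Representatives are chosen arbitrarily; `funMap_mk` removes the choice by congruence. Relation
symbols get a dummy value, since `falsity` never consults it. -/
noncomputable instance : L.Structure (TermModel E) where
  funMap g ds := TermModel.mk E (.func g fun j => (TermModel.exists_mk (ds j)).choose)
  RelMap _ _ := False

theorem TermModel.funMap_mk {k : ℕ} (g : L.Functions k) (as : Fin k → L.Term ℕ) :
    FirstOrder.Language.Structure.funMap g (fun j => mk E (as j)) = mk E (.func g as) :=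
  mk_eq_iff.2 (.congr g fun j => mk_eq_iff.1 (exists_mk (mk E (as j))).choose_spec)

theorem TermModel.realize_mk (t : L.Term ℕ) (σ : ℕ → L.Term ℕ) :
    t.realize (fun i => mk E (σ i)) = mk E (t.subst σ) := by
  induction t with
  | var i => rfl
  | func g ts ih => simp only [FirstOrder.Language.Term.realize_func, ih, funMap_mk, FirstOrder.Language.Term.subst]

/-- A valuation in the quotient lifts to a substitution, and `EqConseq` contains all substitution
instances of E. -/
theorem TermModel.realize_eq (p : L.Term ℕ × L.Term ℕ) (hp : p ∈ E) (v : ℕ → TermModel E) :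
    p.1.realize v = p.2.realize v := by
  choose σ hσ using fun i => exists_mk (v i)
  obtain rfl : (fun i => mk E (σ i)) = v := funext hσ
  rw [realize_mk, realize_mk]
  exact mk_eq_iff.2 (.ax hp σ)

theorem TermModel.realize_zero (zero : L.Functions 0) (v : ℕ → TermModel E) :
    (zeroTerm zero).realize v = mk E (zeroTerm zero) := by
  choose σ hσ using fun i => exists_mk (v i)
  obtain rfl : (fun i => mk E (σ i)) = v := funext hσ
  rw [realize_mk, zeroTerm, FirstOrder.Language.Term.subst]
  congr 2
  exact funext fun j => j.elim0

theorem TermModel.realize_succ (succ : L.Functions 1) {a a' : L.Term ℕ} {v : ℕ → TermModel E}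
    (h : a.realize v = mk E a') :
    (succTerm succ a).realize v = mk E (succTerm succ a') := by
  simp only [succTerm, FirstOrder.Language.Term.realize_func, h, funMap_mk]

/-- A classical integer of value `n` run on `base` and `step` counts up to `n`. -/
theorem IsClassicalInteger.runs {zero : L.Functions 0} {succ : L.Functions 1}
    (hE : Adequate zero succ E) {θ : Term} {n : ℕ} (hθ : IsClassicalInteger zero succ E θ n) :
    Runs n (.clo θ [] []) [.base, .step] 0 := by
  have realize_num : ∀ (i : ℕ) (v : ℕ → TermModel E),
      ((succTerm succ)^[i] (zeroTerm zero)).realize v =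
        TermModel.mk E ((succTerm succ)^[i] (zeroTerm zero)) := by
    intro i v
    induction i with
    | zero => exact TermModel.realize_zero zero v
    | succ i ih =>
      rw [Function.iterate_succ_apply']
      exact TermModel.realize_succ succ ih
  -- The two valuations are placeholders: N[sⁿ(0)] has no free variables. The chosen predicate
  -- matters only at k = 1.
  refine hθ.2.runs TermModel.realize_eq n (fun _ => TermModel.mk E (zeroTerm zero))
    (fun _ _ _ => ∅) [] [] .nil .nil ([.base, .step], 0) (Set.mem_iUnion.2
      ⟨fun k w => {q | q.1 = [] ∧ ∃ i, (∀ j : Fin k,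
        w j = TermModel.mk E ((succTerm succ)^[i] (zeroTerm zero))) ∧ i + q.2 = n},
      _, _, rfl, ?_, _, _, rfl, ?_, ?_⟩)
  -- `base` realizes X(0): as 0 is not a successor modulo E, i = 0 and the counter is n.
  · rintro ⟨π, j⟩ hq
    simp only [falsity, RelVal.push, scons, if_true, Set.mem_ofPred_eq,
      TermModel.realize_zero] at hq
    obtain ⟨rfl, i, hi, hj⟩ := hq
    cases i with
    | zero =>
      obtain rfl : j = n := by omega
      exact .base
    | succ i =>
      refine absurd (TermModel.mk_eq_iff.1 (hi 0).symm) ?_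
      rw [Function.iterate_succ_apply']
      exact hE.1 _
  -- `step` realizes the induction hypothesis: if s(a) = sⁱ(0) then i > 0 and, by injectivity, a =
  -- sⁱ⁻¹(0), which matches the counter j + 1.
  · rintro ⟨π, j⟩ hq
    obtain ⟨d, c, π', rfl, hc, hq⟩ := Set.mem_iUnion.1 hq
    obtain ⟨a, rfl⟩ := TermModel.exists_mk d
    simp only [falsity, RelVal.push, scons, if_true, Set.mem_ofPred_eq] at hq hc
    obtain ⟨rfl, i, hi, hj⟩ := hq
    have hi := hi 0
    rw [TermModel.realize_succ (a' := a) succ rfl, TermModel.mk_eq_iff] at hi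
    cases i with
    | zero => exact absurd hi (hE.1 _)
    | succ i =>
      rw [Function.iterate_succ_apply'] at hi
      exact .step (hc ([], j + 1)
        ⟨rfl, i, fun _ => TermModel.mk_eq_iff.2 (hE.2 _ _ hi), by simp only at hj ⊢; omega⟩)
  · simp only [falsity, RelVal.push, scons, if_true, Set.mem_ofPred_eq]
    exact ⟨trivial, n, fun _ => realize_num n _, by omega⟩

end TermModel

/-! ## Normal terms that run to a number -/

namespace Term

theorem NormalFor.of_lam {R : Term → Term → Prop} {t : Term} (h : NormalFor R (lam t)) :
    NormalFor R t := fun _ ht => h _ (.lam ht)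

theorem NormalFor.of_appL {R : Term → Term → Prop} {t s : Term} (h : NormalFor R (app t s)) :
    NormalFor R t := fun _ ht => h _ (.appL s ht)

theorem NormalFor.of_appR {R : Term → Term → Prop} {t s : Term} (h : NormalFor R (app t s)) :
    NormalFor R s := fun _ hs => h _ (.appR t hs)

theorem NormalFor.of_mu {R : Term → Term → Prop} {b : ℕ} {t : Term} (h : NormalFor R (mu b t)) :
    NormalFor R t := fun _ ht => h _ (.mu b ht)

theorem IsNormal.simplif {t : Term} (h : t.IsNormal) : NormalFor Simplif t := by
  intro t' ht
  have mono : ∀ {a b}, Compat Simplif a b → Compat (fun a b => Calc a b ∨ Simplif a b) a b := by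
    intro a b hab
    induction hab with
    | root h => exact .root (.inr h)
    | lam _ ih => exact .lam ih
    | appL s _ ih => exact .appL s ih
    | appR s _ ih => exact .appR s ih
    | mu b _ ih => exact .mu b ih
  exact h _ (mono ht)

/-- Running a normal term that is neither a `λ` nor a `μ` reaches its head variable. -/
theorem IsNormal.runs_head {n : ℕ} {t : Term} (h : t.IsNormal) (hlam : ∀ u, t ≠ lam u)
    (hmu : ∀ b u, t ≠ mu b u) {e : List Closure} {m : List Stack} {π : List Closure} {j : ℕ}
    (hr : Runs n (.clo t e m) π j) :
    -- Only zero or one argument needs a precise description: `base` runs on an empty stack and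
    -- `step` on a single closure.
    ∃ i c args, e[i]? = some c ∧ Runs n c (args ++ π) j ∧ (args = [] → t = var i) ∧
      ∀ c', args = [c'] → ∃ s, t = app (var i) s ∧ c' = .clo s e m := by
  induction t generalizing π with
  | var i =>
    cases hr with
    | var hc hr => exact ⟨i, _, [], hc, hr, fun _ => rfl, by simp⟩
  | lam u => exact absurd rfl (hlam u)
  | mu b u => exact absurd rfl (hmu b u)
  | app t s iht _ =>
    cases hr with
    | app hr =>
      obtain ⟨i, c, args, hc, hr, hv, _⟩ := iht h.of_appL
        (by rintro u rfl; exact h _ (.root (.inl (.c1 _ _))))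
        (by rintro b u rfl; exact h _ (.root (.inl (.c2 _ _ _)))) hr
      refine ⟨i, c, args ++ [.clo s e m], hc, by simpa using hr, by simp, ?_⟩
      intro c' hc'
      cases args with
      | nil =>
        obtain rfl := hv rfl
        exact ⟨s, rfl, by simpa using hc'.symm⟩
      | cons => simp at hc'

/-- A normal term without free `μ`-variables that runs is a `λ`, or applies a closure of its
environment to the stack. -/
theorem IsNormal.runs_cases {n : ℕ} {t : Term} (h : t.IsNormal) {e π : List Closure} {j : ℕ}
    (hr : Runs n (.clo t e []) π j) :
    (∃ u, t = lam u) ∨ ∃ c ∈ e, ∃ args, Runs n c (args ++ π) j := by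
  by_cases hlam : ∃ u, t = lam u
  · exact .inl hlam
  right
  by_cases hmu : ∃ b u, t = mu b u
  · obtain ⟨b, u, rfl⟩ := hmu
    cases hr with
    | @mu _ _ _ _ _ _ q hq hr =>
      cases b with
      | succ b => simp at hq
      | zero =>
        simp only [List.getElem?_cons_zero, Option.some.injEq] at hq
        subst hq
        -- Under μα[α], a λ would be an (S₃) redex and a μ an (S₁) redex.
        obtain ⟨i, c, args, hc, hr, _⟩ := IsNormal.runs_head h.of_mu
          (by rintro w rfl; exact h _ (.root (.inr (.s3 _ _ (.inl ⟨rfl, _, rfl⟩)))))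
          (by rintro b w rfl; exact h _ (.root (.inr (.s1 _ _ _)))) hr
        exact ⟨c, List.mem_of_getElem? hc, args, hr⟩
  · obtain ⟨i, c, args, hc, hr, _⟩ :=
      h.runs_head (fun u hu => hlam ⟨u, hu⟩) (fun b u hu => hmu ⟨b, u, hu⟩) hr
    exact ⟨c, List.mem_of_getElem? hc, args, hr⟩

/-- `t` is built from `x = var 1` by applications of `f = var 0` and `μ`, and evaluates to `n` when
`j` applications of `f` are pending; `l` lists the numbers of applications of `f` that are pending
at the free `μ`-variables. -/
def Chain (n : ℕ) : List ℕ → Term → ℕ → Prop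
  | _, var i, j => i = 1 ∧ j = n
  | _, lam _, _ => False
  | l, app t s, j => t = var 0 ∧ Chain n l s (j + 1)
  | l, mu b t, j => ∃ j', (j :: l)[b]? = some j' ∧ Chain n (j :: l) t j'

/-- On an empty stack a λ is stuck, x must stand alone, and f takes exactly one argument. Every
saved stack is empty too, so only its counter is remembered. -/
theorem IsNormal.chain {n : ℕ} {t : Term} (h : t.IsNormal) {l : List ℕ} {j : ℕ}
    (hr : Runs n (.clo t [.step, .base] (l.map fun i => ([], i))) [] j) : Chain n l t j := by
  induction t generalizing l j with
  | lam u => cases hr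
  | mu b u ih =>
    cases hr with
    | @mu _ _ _ _ _ _ q hq hr =>
      have hq' : ((j :: l).map fun i => (([], i) : Stack))[b]? = some q := hq
      rw [List.getElem?_map, Option.map_eq_some_iff] at hq'
      obtain ⟨j', hj', rfl⟩ := hq'
      exact ⟨j', hj', ih h.of_mu hr⟩
  | var i =>
    cases hr with
    | @var _ _ c _ _ _ hc hr =>
      match i, hc with
      | 0, hc => simp at hc; subst hc; cases hr
      | 1, hc => simp at hc; subst hc; cases hr; exact ⟨rfl, rfl⟩
      | i + 2, hc => simp at hc
  | app t s _ ihs =>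
    obtain ⟨i, c, args, hc, hr, hv, ha⟩ := h.runs_head (by simp) (by simp) hr
    rw [List.append_nil] at hr
    match i, hc with
    | 0, hc =>
      simp at hc
      subst hc
      cases hr with
      | step hr =>
        obtain ⟨s', hs, rfl⟩ := ha _ rfl
        obtain ⟨rfl, rfl⟩ := Term.app.inj hs
        exact ⟨rfl, ihs h.of_appR hr⟩
    | 1, hc =>
      simp at hc
      subst hc
      cases hr
      simp at hv
    | i + 2, hc => simp at hc

/-- Without the first λ some closure of the empty environment would run; without the second, `base`
would face a stack still containing `step`. -/
theorem IsNormal.eq_lam_lam {n : ℕ} {θ : Term} (h : θ.IsNormal)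
    (hr : Runs n (.clo θ [] []) [.base, .step] 0) : ∃ t, θ = lam (lam t) ∧ Chain n [] t 0 := by
  obtain ⟨u, rfl⟩ | ⟨c, hc, -⟩ := h.runs_cases hr
  swap
  · simp at hc
  cases hr with
  | lam hr =>
    obtain ⟨t, rfl⟩ | ⟨c, hc, args, hr⟩ := IsNormal.runs_cases h.of_lam hr
    · cases hr with
      | lam hr => exact ⟨t, rfl, IsNormal.chain (l := []) h.of_lam.of_lam hr⟩
    · obtain rfl := List.mem_singleton.1 hc
      generalize hπ : args ++ [Closure.step] = π at hr
      cases hr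
      simp at hπ

/-! ## Cleaning -/

/-- The number of nodes of a term. -/
def size : Term → ℕ
  | var _ => 1
  | lam t => size t + 1
  | app t s => size t + size s + 1
  | mu _ t => size t + 1

theorem size_renMu (ρ : ℕ → ℕ) (t : Term) : (renMu ρ t).size = t.size := by
  induction t generalizing ρ with
  | var i => rfl
  | lam t ih => simp [renMu, size, ih]
  | app t s iht ihs => simp [renMu, size, iht, ihs]
  | mu b t ih => simp [renMu, size, ih]

theorem Chain.renMu {n : ℕ} {t : Term} {l l' : List ℕ} {j : ℕ} {ρ : ℕ → ℕ} (h : Chain n l t j)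
    (hρ : ∀ i a, l[i]? = some a → l'[ρ i]? = some a) : Chain n l' (renMu ρ t) j := by
  induction t generalizing l l' j ρ with
  | var i => exact h
  | lam t => exact h.elim
  | app t s _ ih =>
    obtain ⟨rfl, h⟩ := h
    exact ⟨rfl, ih h hρ⟩
  | mu b t ih =>
    obtain ⟨j', hj', h⟩ := h
    have up : ∀ i a, (j :: l)[i]? = some a → (j :: l')[upRen ρ i]? = some a := by
      intro i a hi
      cases i with
      | zero => exact hi
      | succ i => simpa [upRen, scons] using hρ i a (by simpa using hi)
    exact ⟨j', up _ _ hj', ih h up⟩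

/-- Needed for (S₂), which removes an unused μ-index. -/
theorem Chain.of_renMu {n : ℕ} {t : Term} {l l' : List ℕ} {j : ℕ} {ρ : ℕ → ℕ}
    (h : Chain n l' (Term.renMu ρ t) j) (hρ : ∀ i a, l'[ρ i]? = some a → l[i]? = some a) :
    Chain n l t j := by
  induction t generalizing l l' j ρ with
  | var i => exact h
  | lam t => exact h.elim
  | app t s _ ih =>
    obtain ⟨ht, h⟩ := h
    refine ⟨?_, ih h hρ⟩
    cases t <;> simp_all [Term.renMu]
  | mu b t ih =>
    obtain ⟨j', hj', h⟩ := h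
    have up : ∀ i a, (j :: l')[upRen ρ i]? = some a → (j :: l)[i]? = some a := by
      intro i a hi
      cases i with
      | zero => exact hi
      | succ i => simpa using hρ i a (by simpa [upRen, scons] using hi)
    exact ⟨j', up _ _ hj', ih h up⟩

theorem Chain.not_namesLam {n : ℕ} {t : Term} {l : List ℕ} {j : ℕ} (h : Chain n l t j) (a : ℕ) :
    ¬ NamesLam a t := by
  induction t generalizing l j a with
  | var i => exact id
  | lam t => exact h.elim
  | app t s _ ih =>
    obtain ⟨rfl, h⟩ := h
    rintro (h' | h')
    · exact h'
    · exact ih h a h'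
  | mu b t ih =>
    obtain ⟨j', hj', h⟩ := h
    rintro (⟨-, w, rfl⟩ | h')
    · exact h
    · exact ih h _ h'

/-- (S₁) and (S₂) only redirect names to equal counters and delete a μ; (S₃), the one rule that
could enlarge the term, needs a λ. -/
theorem Chain.simplif {n : ℕ} {t t' : Term} {l : List ℕ} {j : ℕ} (h : Chain n l t j)
    (hs : Compat Simplif t t') : Chain n l t' j ∧ t'.size < t.size := by
  induction hs generalizing l j with
  | root hs =>
    cases hs with
    | s1 a c t =>
      obtain ⟨j₁, h₁, j₂, h₂, h⟩ := h
      -- The inner μ saved j₁, which is the counter already stored under the name a.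
      have hρ : ∀ i x, (j₁ :: j :: l)[i]? = some x → (j :: l)[scons a id i]? = some x := by
        intro i x hi
        cases i with
        | zero => simp_all [scons]
        | succ i => simpa [scons] using hi
      exact ⟨⟨j₂, hρ _ _ h₂, h.renMu hρ⟩, by simp [size, size_renMu]⟩
    | s2 t =>
      obtain ⟨j', hj', h⟩ := h
      obtain rfl : j = j' := by simpa using hj'
      exact ⟨h.of_renMu (by simp), by simp [size, shiftMu, size_renMu]⟩
    | s3 b t h' =>
      obtain ⟨j', hj', h⟩ := h
      rcases h' with ⟨-, w, rfl⟩ | h'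
      · exact h.elim
      · exact absurd h' (h.not_namesLam 0)
  | lam _ ih => exact h.elim
  | appL s hs ih =>
    obtain ⟨rfl, h⟩ := h
    cases hs with
    | root hs => cases hs
  | appR s _ ih =>
    obtain ⟨rfl, h⟩ := h
    have := ih h
    exact ⟨⟨rfl, this.1⟩, by simpa [size] using this.2⟩
  | mu b _ ih =>
    obtain ⟨j', hj', h⟩ := h
    have := ih h
    exact ⟨⟨j', hj', this.1⟩, by simpa [size] using this.2⟩

theorem Chain.exists_normalFor {n : ℕ} {l : List ℕ} {j : ℕ} {t : Term} (h : Chain n l t j) :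
    ∃ t', Relation.ReflTransGen (Compat Simplif) t t' ∧ NormalFor Simplif t' ∧ Chain n l t' j ∧
      t'.size ≤ t.size := by
  induction hN : t.size using Nat.strong_induction_on generalizing t with
  | _ N ih =>
    subst hN
    by_cases hn : NormalFor Simplif t
    · exact ⟨t, .refl, hn, h, le_rfl⟩
    · obtain ⟨u, hu⟩ : ∃ u, Compat Simplif t u := by simpa [NormalFor] using hn
      obtain ⟨hc, hlt⟩ := h.simplif hu
      obtain ⟨t', h₁, h₂, h₃, h₄⟩ := ih _ hlt hc rfl
      exact ⟨t', .head hu h₁, h₂, h₃, h₄.trans hlt.le⟩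

theorem renMu_iterate_app (ρ : ℕ → ℕ) (k : ℕ) :
    renMu ρ ((app (var 0))^[k] (var 1)) = (app (var 0))^[k] (var 1) := by
  induction k with
  | zero => rfl
  | succ k ih => simp only [Function.iterate_succ_apply', renMu, ih]

theorem substLeft_iterate_app (a : ℕ) (s : Term) (k : ℕ) :
    substLeft a s ((app (var 0))^[k] (var 1)) = (app (var 0))^[k] (var 1) := by
  induction k with
  | zero => rfl
  | succ k ih => simp only [Function.iterate_succ_apply', substLeft, ih]

theorem chain_iterate_app {n k j : ℕ} {l : List ℕ} :
    Chain n l ((app (var 0))^[k] (var 1)) j ↔ k + j = n := by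
  induction k generalizing j with
  | zero => simp [Chain]
  | succ k ih =>
    simp only [Function.iterate_succ_apply', Chain, ih, true_and]
    omega

/-- A chain in simplified form is `(f)ᵏx`, or `μα[β](f)ᵏx` with `β ≠ α`, or allows a cleaning step
which makes it smaller. -/
theorem Chain.clean_cases {n : ℕ} {t : Term} {l : List ℕ} {j : ℕ} (h : Chain n l t j)
    (hn : NormalFor Simplif t) :
    (∃ k, t = (app (var 0))^[k] (var 1)) ∨
      (∃ b k, t = mu (b + 1) ((app (var 0))^[k] (var 1))) ∨
      ∃ t', Compat Clean t t' ∧ Chain n l t' j ∧ t'.size < t.size := by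
  induction t generalizing l j with
  | var i =>
    obtain ⟨rfl, -⟩ := h
    exact .inl ⟨0, rfl⟩
  | lam t => exact h.elim
  | app t s _ ih =>
    obtain ⟨rfl, h⟩ := h
    obtain ⟨k, rfl⟩ | ⟨b, k, rfl⟩ | ⟨s', h₁, h₂, h₃⟩ := ih h hn.of_appR
    · exact .inl ⟨k + 1, (Function.iterate_succ_apply' _ _ _).symm⟩
    · refine .inr (.inr ⟨_, .root (.n _ _ _), ?_⟩)
      -- The name b + 1 skips the count saved by its own μ, so j' comes from l and losing one f does
      -- not affect it.
      obtain ⟨j', hj', h⟩ := h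
      simp only [muLeft, Nat.add_eq_zero_iff, one_ne_zero, and_false, if_false,
        substLeft_iterate_app]
      exact ⟨⟨j', by simpa using hj', chain_iterate_app.2 (chain_iterate_app.1 h)⟩,
        by simp [size]⟩
    · exact .inr (.inr ⟨_, .appR _ h₁, ⟨rfl, h₂⟩, by simpa [size] using h₃⟩)
  | mu b t ih =>
    obtain ⟨j', hj', h⟩ := h
    obtain ⟨k, rfl⟩ | ⟨b', k, rfl⟩ | ⟨s', h₁, h₂, h₃⟩ := ih h hn.of_mu
    · cases b with
      | zero =>
        -- Containing no μ-variable, (f)ᵏx is its own shift, hence an (S₂) redex.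
        have := Simplif.s2 ((app (var 0))^[k] (var 1))
        rw [shiftMu, renMu_iterate_app] at this
        exact absurd (.root this) (hn _)
      | succ b => exact .inr (.inl ⟨b, k, rfl⟩)
    · exact absurd (.root (.s1 _ _ _)) (hn _)
    · exact .inr (.inr ⟨_, .mu _ h₁, ⟨j', hj', h₂⟩, by simpa [size] using h₃⟩)

theorem NormalFor.lam_simplif {t : Term} (h : NormalFor Simplif t) : NormalFor Simplif (lam t) := by
  intro u hu
  cases hu with
  | root h' => cases h'
  | lam h' => exact h _ h'

/-- Induction on size: the cleaning strictly shrinks the term and the simplifications that follow do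
not enlarge it. -/
theorem Chain.cleansTo {n : ℕ} {t : Term} (h : Chain n [] t 0) (hn : NormalFor Simplif t) :
    CleansTo (lam (lam t)) (church n) := by
  induction hN : t.size using Nat.strong_induction_on generalizing t with
  | _ N ih =>
    subst hN
    obtain ⟨k, rfl⟩ | ⟨b, k, rfl⟩ | ⟨u, h₁, h₂, h₃⟩ := h.clean_cases hn
    · obtain rfl : k = n := by simpa using chain_iterate_app.1 h
      exact .refl
    -- Here l = [], so a name b + 1 has no counter to refer to.
    · obtain ⟨j', hj', -⟩ := h
      simp at hj'
    · obtain ⟨t', hs, hn', hc, hle⟩ := h₂.exists_normalFor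
      exact .head ⟨_, .lam (.lam h₁), hs.lift (fun t => lam (lam t)) fun _ _ h => .lam (.lam h),
        hn'.lam_simplif.lam_simplif⟩ (ih _ (hle.trans_lt h₃) hc hn' rfl)

end Term

end LambdaMu

theorem mainTheorem2 {L : FirstOrder.Language.{u, v}}
    (zero : L.Functions 0) (succ : L.Functions 1)
    (E : Set (L.Term ℕ × L.Term ℕ)) (hE : LambdaMu.Adequate zero succ E)
    (θ : LambdaMu.Term) (n : ℕ)
    (hθ : LambdaMu.IsClassicalInteger zero succ E θ n) (hnormal : θ.IsNormal) :
    θ.CleansTo (LambdaMu.Term.church n) := by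
  obtain ⟨t, rfl, ht⟩ := hnormal.eq_lam_lam (hθ.runs hE)
  exact ht.cleansTo hnormal.simplif.of_lam.of_lam
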